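/- A polymatroid on a finite set $N$ is a function $f$ that assigns a real number to every subset of $N$, with $f(\emptyset)=0$, and is non-negative, monotone ($f(A)\le f(B)$ for $A\subseteq B$) and submodular ($f(A\cup B)+f(A\cap B)\le f(A)+f(B)$). For pairwise disjoint sets $I,J,K\subseteq N$ write $$f(I,J|K)=f(I\cup K)+f(J\cup K)-f(I\cup J\cup K)-f(K),\qquad f(I,J)=f(I,J|\emptyset),\qquad f(I|K)=f(I\cup K)-f(K),$$ where braces around singletons and union signs are omitted (so $abc=\{a,b,c\}$). Theorem. Let $a,b,c,x,y$ be five distinct points, and let $f_x$ and $f_y$ be polymatroids on $abcx$ and $abcy$ that agree on all subsets of $abc$. Then $f_x$ and $f_y$ have an amalgam, that is, there is a polymatroid on $abcxy$ whose restrictions to $abcx$ and $abcy$ are $f_x$ and $f_y$, if and only if the inequalities $$f_x(a,x|c)+f_x(a,b|x)+f_y(a,b|y)+f_y(c,y)+\begin{Bmatrix}f_x(b,x|ac)\\ f_y(b,y|ac)\end{Bmatrix}+\begin{Bmatrix}f_x(c,x|ab)\\ f_y(c,y|ab)\end{Bmatrix}+2\begin{Bmatrix}f_x(x|abc)\\ f_y(y|abc)\end{Bmatrix}\;\ge\;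 f_x(a,b)$$ hold for each of the $2^3$ independent choices of one term in each of the three braces, and so do all the inequalities obtained from these by permuting $a,b,c$ and by exchanging $x$ and $y$ (together with $f_x$ and $f_y$). -/

import Mathlib

namespace PolymatroidAmalgam

variable {α : Type*} [DecidableEq α]

/-- `f` is (the rank function of) a polymatroid on the finite ground set `M`: on the subsets of `M`
it is non-negative, monotone and submodular, with the convention `f ∅ = 0`.
The values of `f` on sets that are not contained in `M` are irrelevant. -/
structure IsPolymatroid (M : Finset α) (f : Finset α → ℝ) : Prop where
  empty : f ∅ = 0
  nonneg : ∀ A : Finset α, A ⊆ M → 0 ≤ f A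
  mono : ∀ A B : Finset α, A ⊆ B → B ⊆ M → f A ≤ f B
  submod : ∀ A B : Finset α, A ⊆ M → B ⊆ M → f (A ∪ B) + f (A ∩ B) ≤ f A + f B

/-- `f` and `g` take the same values on all subsets of `M`. -/
def AgreeOn (M : Finset α) (f g : Finset α → ℝ) : Prop :=
  ∀ A : Finset α, A ⊆ M → f A = g A

/-- The polymatroids `f` on `M₁` and `g` on `M₂` have an amalgam: some polymatroid on `M₁ ∪ M₂`
extends both of them. -/
def HasAmalgam (M₁ M₂ : Finset α) (f g : Finset α → ℝ) : Prop :=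
  ∃ h : Finset α → ℝ, IsPolymatroid (M₁ ∪ M₂) h ∧ AgreeOn M₁ h f ∧ AgreeOn M₂ h g

/-- `f(I, J | K) = f(IK) + f(JK) - f(IJK) - f(K)`. -/
def condInfo (f : Finset α → ℝ) (I J K : Finset α) : ℝ :=
  f (I ∪ K) + f (J ∪ K) - f (I ∪ J ∪ K) - f K

/-- `f(I, J) = f(I, J | ∅)`. -/
def info (f : Finset α → ℝ) (I J : Finset α) : ℝ :=
  condInfo f I J ∅

/-- `f(I | K) = f(IK) - f(K)`. -/
def condRank (f : Finset α → ℝ) (I K : Finset α) : ℝ :=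
  f (I ∪ K) - f K

/-- The instance of the amalgam inequality for `f` on `abcx` and `g` on `abcy`, in this order of
the points. The terms `t₁`, `t₂`, `t₃` are chosen independently of each other, so that this is a
conjunction of eight inequalities. -/
def AmalgamInequality (f g : Finset α → ℝ) (a b c x y : α) : Prop :=
  ∀ t₁ ∈ ({condInfo f {b} {x} {a, c}, condInfo g {b} {y} {a, c}} : Set ℝ),
  ∀ t₂ ∈ ({condInfo f {c} {x} {a, b}, condInfo g {c} {y} {a, b}} : Set ℝ),
  ∀ t₃ ∈ ({condRank f {x} {a, b, c}, condRank g {y} {a, b, c}} : Set ℝ),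
    info f {a} {b} ≤
      condInfo f {a} {x} {c} + condInfo f {a} {b} {x} + condInfo g {a} {b} {y} + info g {c} {y}
        + t₁ + t₂ + 2 * t₃

end PolymatroidAmalgam

/-!
An amalgam `h` on `E ∪ {x, y}`, where `E = {a, b, c}`, is determined by the eight unknown values
`z A = h (A ∪ {x, y})` for `A ⊆ E`. Being a polymatroid amounts to the elemental inequalities
(`Elemental.isPolymatroid`), and those that involve `z` say (`elemental_glue`) that

* `z A ≤ U A`, where `U A = f_x(Ax) + f_y(Ay) - f_x(A)` (`upper`);
* `z (A ∪ {p}) - z A ≤ s A p`, the smaller one of the increments of `f_x` from `Ax` to `Apx` and of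
  `f_y` from `Ay` to `Apy` (`step`);
* `z` is submodular;
* `z E` is at least `z (E \ {p})` for every `p` and at least
  `m = max (f_x(abcx)) (f_y(abcy))` (`top`).

The system is solved by choosing extremal values. Decreasing `z E` while keeping all the differences
`z E - z A` only helps, so `z E = m`. Then `z E - z (E \ {r})` may be taken as large as possible,
namely `s (E \ {r}) r`: apart from this upper bound, every constraint that remains after
eliminating the values on smaller sets bounds these differences, or sums of two of them, from below.
The values at singletons and at `∅` can then be chosen if and only if
`2 m ≤ U {p} + U {q} + s (E \ {q}) q + s (E \ {r}) r + s ∅ r + s {r} p`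
for every ordering `p, q, r` of `E` (`exists_submodular_of_step_bounds`); adding up constraints
shows that these conditions are also necessary (`two_top_le_of_extension`).

It remains to expand the extrema. If the minima in `s ∅ r` and `s {r} p` are both attained by the
same polymatroid, then the condition holds automatically (`two_top_le_of_same`). If the first is
attained by `f_x` and the second by `f_y`, the eight choices for `m`, `s (E \ {q}) q` and
`s (E \ {r}) r` give exactly the eight amalgam inequalities (`amalgamInequality_iff`), and the
remaining case arises by exchanging `x` and `y`.
-/

namespace PolymatroidAmalgam

variable {α : Type*} [DecidableEq α]

/-! ### Polymatroids from elemental inequalities -/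

/-- The elemental inequalities on the ground set `N`: submodularity for two distinct points over a
set containing neither, and monotonicity for the removal of one point from `N`. -/
structure Elemental (N : Finset α) (f : Finset α → ℝ) : Prop where
  submod : ∀ (K : Finset α) (i j : α), K ⊆ N → i ∈ N → j ∈ N → i ∉ K → j ∉ K → i ≠ j →
    f (insert i (insert j K)) + f K ≤ f (insert i K) + f (insert j K)
  mono : ∀ i ∈ N, f (N.erase i) ≤ f N

namespace Elemental

variable {N : Finset α} {f : Finset α → ℝ}

/-- The increments of `f` decrease as the set grows. -/
lemma increment_le (hf : Elemental N f) {K L : Finset α} (hKL : K ⊆ L) (hL : L ⊆ N) {i : α}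
    (hi : i ∈ N) (hiL : i ∉ L) : f (insert i L) + f K ≤ f (insert i K) + f L := by
  obtain ⟨S, rfl⟩ : ∃ S, L = K ∪ S := ⟨L, (Finset.union_eq_right.2 hKL).symm⟩
  clear hKL
  induction S using Finset.induction_on with
  | empty => simp
  | insert j S _ ih =>
    have ih := ih (by grind) (by grind)
    by_cases hj : j ∈ K ∪ S
    · rwa [Finset.union_insert, Finset.insert_eq_of_mem hj]
    · have := hf.submod (K ∪ S) i j (by grind) hi (by grind) (by grind) hj (by grind)
      rw [Finset.union_insert]
      linarith

lemma union_add_le (hf : Elemental N f) {B C T : Finset α} (hC : C ⊆ B) (hB : B ⊆ N) (hT : T ⊆ N)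
    (hTB : Disjoint T B) : f (B ∪ T) + f C ≤ f (C ∪ T) + f B := by
  induction T using Finset.induction_on with
  | empty => simp [add_comm]
  | insert j T hj ih =>
    rw [Finset.disjoint_insert_left] at hTB
    have ih := ih (by grind) hTB.2
    have := hf.increment_le (K := C ∪ T) (L := B ∪ T) (i := j) (by grind) (by grind) (by grind)
      (by grind)
    rw [Finset.union_insert, Finset.union_insert]
    linarith

lemma le_insert (hf : Elemental N f) {K : Finset α} {i : α} (hK : K ⊆ N) (hi : i ∈ N) :
    f K ≤ f (insert i K) := by
  by_cases hiK : i ∈ K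
  · rw [Finset.insert_eq_of_mem hiK]
  · have h := hf.increment_le (K := K) (L := N.erase i) (i := i) (by grind) (by grind) hi (by simp)
    rw [Finset.insert_erase hi] at h
    linarith [hf.mono i hi]

theorem isPolymatroid (hf : Elemental N f) (h0 : f ∅ = 0) : IsPolymatroid N f := by
  have mono : ∀ A B : Finset α, A ⊆ B → B ⊆ N → f A ≤ f B := by
    intro A B hAB hB
    obtain ⟨S, rfl⟩ : ∃ S, B = A ∪ S := ⟨B, (Finset.union_eq_right.2 hAB).symm⟩
    clear hAB
    induction S using Finset.induction_on with
    | empty => simp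
    | insert j S _ ih =>
      rw [Finset.union_insert]
      exact (ih (by grind)).trans (hf.le_insert (by grind) (by grind))
  refine ⟨h0, fun A hA => h0 ▸ mono ∅ A (by simp) hA, mono, fun A B hA hB => ?_⟩
  have h := hf.union_add_le (B := B) (C := A ∩ B) (T := A \ B) (by grind) hB (by grind)
    Finset.sdiff_disjoint
  rwa [Finset.union_sdiff_self_eq_union, Finset.union_comm B, Finset.union_comm (A ∩ B),
    Finset.sdiff_union_inter] at h

end Elemental

/-! ### Gluing two one-point extensions -/

/-- `f` and `g` are extended to a common function whose value on `A ∪ {x, y}` is `z A`. -/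
def glue (f g z : Finset α → ℝ) (x y : α) (S : Finset α) : ℝ :=
  if x ∈ S ∧ y ∈ S then z ((S.erase x).erase y) else if y ∈ S then g S else f S

section Glue

variable {f g z : Finset α → ℝ} {x y : α} {E A : Finset α}

lemma glue_of_notMem_right (hy : y ∉ A) : glue f g z x y A = f A := by
  simp [glue, hy]

lemma glue_insert_right (hxy : x ≠ y) (hx : x ∉ A) :
    glue f g z x y (insert y A) = g (insert y A) := by
  simp [glue, hx, hxy]

lemma glue_insert_insert (hxy : x ≠ y) (hx : x ∉ A) (hy : y ∉ A) :
    glue f g z x y (insert x (insert y A)) = z A := by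
  rw [glue, if_pos (by simp), Finset.erase_insert (by simp [hxy, hx]), Finset.erase_insert hy]

/-- A subset of `E ∪ {x, y}` is a subset of `E` to which none, one or both of `x` and `y` are
added. -/
lemma subset_insert_insert_cases {K : Finset α} (hK : K ⊆ insert x (insert y E)) :
    ∃ A ⊆ E, K = A ∨ K = insert x A ∨ K = insert y A ∨ K = insert x (insert y A) := by
  refine ⟨(K.erase x).erase y, by grind, ?_⟩
  by_cases h1 : x ∈ K <;> by_cases h2 : y ∈ K <;> grind

lemma IsPolymatroid.insert_insert_le {N K : Finset α} (hf : IsPolymatroid N f) {i j : α}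
    (hK : K ⊆ N) (hi : i ∈ N) (hj : j ∈ N) (hiK : i ∉ K) (hij : i ≠ j) :
    f (insert i (insert j K)) + f K ≤ f (insert i K) + f (insert j K) := by
  have h := hf.submod (insert i K) (insert j K) (by grind) (by grind)
  rwa [show insert i K ∪ insert j K = insert i (insert j K) by grind,
    show insert i K ∩ insert j K = K by grind] at h

/-- The conditions on `z` are the elemental inequalities for the glued function that involve a set
containing both `x` and `y`; the others hold because `f` and `g` are polymatroids. -/
lemma elemental_glue (hxy : x ≠ y) (hx : x ∉ E) (hy : y ∉ E)
    (hf : IsPolymatroid (insert x E) f) (hg : IsPolymatroid (insert y E) g) (hfg : AgreeOn E f g)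
    (hz : ∀ A ⊆ E, z A + f A ≤ f (insert x A) + g (insert y A))
    (hzf : ∀ A ⊆ E, ∀ p ∈ E, p ∉ A →
      z (insert p A) + f (insert x A) ≤ z A + f (insert x (insert p A)))
    (hzg : ∀ A ⊆ E, ∀ p ∈ E, p ∉ A →
      z (insert p A) + g (insert y A) ≤ z A + g (insert y (insert p A)))
    (hsub : ∀ A ⊆ E, ∀ p ∈ E, ∀ q ∈ E, p ∉ A → q ∉ A → p ≠ q →
      z (insert p (insert q A)) + z A ≤ z (insert p A) + z (insert q A))
    (hf_le : f (insert x E) ≤ z E) (hg_le : g (insert y E) ≤ z E)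
    (hmono : ∀ p ∈ E, z (E.erase p) ≤ z E) :
    Elemental (insert x (insert y E)) (glue f g z x y) := by
  have e0 : ∀ A ⊆ E, glue f g z x y A = f A := fun A hA => glue_of_notMem_right fun h => hy (hA h)
  have ex : ∀ A ⊆ E, glue f g z x y (insert x A) = f (insert x A) :=
    fun A hA => glue_of_notMem_right (by simpa [hxy.symm] using fun h => hy (hA h))
  have ey : ∀ A ⊆ E, glue f g z x y (insert y A) = g (insert y A) :=
    fun A hA => glue_insert_right hxy fun h => hx (hA h)
  have exy : ∀ A ⊆ E, glue f g z x y (insert x (insert y A)) = z A :=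
    fun A hA => glue_insert_insert hxy (fun h => hx (hA h)) fun h => hy (hA h)
  have subf : ∀ A ⊆ E, A ⊆ insert x E := fun A hA => hA.trans (Finset.subset_insert _ _)
  have subg : ∀ A ⊆ E, A ⊆ insert y E := fun A hA => hA.trans (Finset.subset_insert _ _)
  have ins : ∀ p ∈ E, ∀ A ⊆ E, insert p A ⊆ E := fun p hp A hA => Finset.insert_subset hp hA
  have hxy_sub : ∀ K ⊆ insert x (insert y E), x ∉ K → y ∉ K →
      glue f g z x y (insert x (insert y K)) + glue f g z x y K ≤
        glue f g z x y (insert x K) + glue f g z x y (insert y K) := by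
    intro K hK hxK hyK
    obtain ⟨A, hA, rfl | rfl | rfl | rfl⟩ := subset_insert_insert_cases hK
    · rw [exy _ hA, e0 _ hA, ex _ hA, ey _ hA]
      exact hz _ hA
    all_goals simp at hxK hyK
  have hxp_sub : ∀ K ⊆ insert x (insert y E), ∀ p ∈ E, x ∉ K → p ∉ K →
      glue f g z x y (insert x (insert p K)) + glue f g z x y K ≤
        glue f g z x y (insert x K) + glue f g z x y (insert p K) := by
    intro K hK p hp hxK hpK
    have hxp : x ≠ p := fun h => hx (h ▸ hp)
    obtain ⟨A, hA, rfl | rfl | rfl | rfl⟩ := subset_insert_insert_cases hK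
    · rw [ex _ (ins p hp _ hA), e0 _ hA, ex _ hA, e0 _ (ins p hp _ hA)]
      exact hf.insert_insert_le (subf _ hA) (by simp) (by simp [hp]) hxK hxp
    · simp at hxK
    · rw [Finset.insert_comm p y, exy _ (ins p hp _ hA), ey _ hA, exy _ hA, ey _ (ins p hp _ hA)]
      exact hzg A hA p hp fun h => hpK (Finset.mem_insert_of_mem h)
    · simp at hxK
  have hyp_sub : ∀ K ⊆ insert x (insert y E), ∀ p ∈ E, y ∉ K → p ∉ K →
      glue f g z x y (insert y (insert p K)) + glue f g z x y K ≤
        glue f g z x y (insert y K) + glue f g z x y (insert p K) := by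
    intro K hK p hp hyK hpK
    have hyp : y ≠ p := fun h => hy (h ▸ hp)
    obtain ⟨A, hA, rfl | rfl | rfl | rfl⟩ := subset_insert_insert_cases hK
    · rw [ey _ (ins p hp _ hA), e0 _ hA, ey _ hA, e0 _ (ins p hp _ hA), hfg _ hA,
        hfg _ (ins p hp _ hA)]
      exact hg.insert_insert_le (subg _ hA) (by simp) (by simp [hp]) hyK hyp
    · rw [Finset.insert_comm p x, Finset.insert_comm y x, Finset.insert_comm y x,
        exy _ (ins p hp _ hA), ex _ hA, exy _ hA, ex _ (ins p hp _ hA)]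
      exact hzf A hA p hp fun h => hpK (Finset.mem_insert_of_mem h)
    all_goals simp at hyK
  have hpq_sub : ∀ K ⊆ insert x (insert y E), ∀ p ∈ E, ∀ q ∈ E, p ∉ K → q ∉ K → p ≠ q →
      glue f g z x y (insert p (insert q K)) + glue f g z x y K ≤
        glue f g z x y (insert p K) + glue f g z x y (insert q K) := by
    intro K hK p hp q hq hpK hqK hpq
    obtain ⟨A, hA, rfl | rfl | rfl | rfl⟩ := subset_insert_insert_cases hK
    · rw [e0 _ (ins p hp _ (ins q hq _ hA)), e0 _ hA, e0 _ (ins p hp _ hA), e0 _ (ins q hq _ hA)]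
      exact hf.insert_insert_le (subf _ hA) (by simp [hp]) (by simp [hq]) hpK hpq
    · have h := hf.insert_insert_le (Finset.insert_subset_insert x hA) (by simp [hp])
        (by simp [hq]) hpK hpq
      rw [Finset.insert_comm q x, Finset.insert_comm p x, Finset.insert_comm p x] at h ⊢
      rwa [ex _ (ins p hp _ (ins q hq _ hA)), ex _ hA, ex _ (ins p hp _ hA), ex _ (ins q hq _ hA)]
    · have h := hg.insert_insert_le (Finset.insert_subset_insert y hA) (by simp [hp])
        (by simp [hq]) hpK hpq
      rw [Finset.insert_comm q y, Finset.insert_comm p y, Finset.insert_comm p y] at h ⊢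
      rwa [ey _ (ins p hp _ (ins q hq _ hA)), ey _ hA, ey _ (ins p hp _ hA), ey _ (ins q hq _ hA)]
    · rw [Finset.insert_comm q x, Finset.insert_comm q y, Finset.insert_comm p x,
        Finset.insert_comm p y, Finset.insert_comm p x, Finset.insert_comm p y,
        exy _ (ins p hp _ (ins q hq _ hA)), exy _ hA, exy _ (ins p hp _ hA),
        exy _ (ins q hq _ hA)]
      exact hsub A hA p hp q hq (fun h => hpK (by simp [h])) (fun h => hqK (by simp [h])) hpq
  refine ⟨fun K i j hK hi hj hiK hjK hij => ?_, fun i hi => ?_⟩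
  · simp only [Finset.mem_insert] at hi hj
    rcases hi with rfl | rfl | hi <;> rcases hj with rfl | rfl | hj
    · exact absurd rfl hij
    · exact hxy_sub K hK hiK hjK
    · exact hxp_sub K hK j hj hiK hjK
    · rw [Finset.insert_comm, add_comm (glue f g z _ _ (insert i K))]
      exact hxy_sub K hK hjK hiK
    · exact absurd rfl hij
    · exact hyp_sub K hK j hj hiK hjK
    · rw [Finset.insert_comm, add_comm (glue f g z _ _ (insert i K))]
      exact hxp_sub K hK i hi hjK hiK
    · rw [Finset.insert_comm, add_comm (glue f g z _ _ (insert i K))]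
      exact hyp_sub K hK i hi hjK hiK
    · exact hpq_sub K hK i hi j hj hiK hjK hij
  · rw [exy _ subset_rfl]
    simp only [Finset.mem_insert] at hi
    rcases hi with rfl | rfl | hi
    · rw [Finset.erase_insert (by simp [hxy, hx]), ey _ subset_rfl]
      exact hg_le
    · rw [Finset.insert_comm, Finset.erase_insert (by simp [hxy.symm, hy]), ex _ subset_rfl]
      exact hf_le
    · have hxi : x ≠ i := fun h => hx (h ▸ hi)
      have hyi : y ≠ i := fun h => hy (h ▸ hi)
      rw [Finset.erase_insert_of_ne hxi, Finset.erase_insert_of_ne hyi,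
        exy _ (Finset.erase_subset _ _)]
      exact hmono i hi

end Glue

/-! ### Solving the linear system on a three-element set -/

lemma eq_triple {E : Finset α} (hE : E.card = 3) {p q r : α} (hp : p ∈ E) (hq : q ∈ E) (hr : r ∈ E)
    (hpq : p ≠ q) (hpr : p ≠ r) (hqr : q ≠ r) : E = {p, q, r} := by
  refine (Finset.eq_of_subset_of_card_le (by grind) ?_).symm
  rw [hE, Finset.card_eq_three.2 ⟨p, q, r, hpq, hpr, hqr, rfl⟩]

lemma exists_third {E : Finset α} (hE : E.card = 3) (p q : α) : ∃ r ∈ E, p ≠ r ∧ q ≠ r := by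
  obtain ⟨r, hr⟩ := Finset.exists_mem_notMem_of_card_lt_card
    (s := {p, q}) (t := E) (by have := Finset.card_le_two (a := p) (b := q); omega)
  exact ⟨r, by grind⟩

lemma erase_eq_pair {E : Finset α} (hE : E.card = 3) {p q r : α} (hp : p ∈ E) (hq : q ∈ E)
    (hr : r ∈ E) (hpq : p ≠ q) (hpr : p ≠ r) (hqr : q ≠ r) : E.erase r = {p, q} := by
  rw [eq_triple hE hp hq hr hpq hpr hqr]; grind

lemma subset_cases {E A : Finset α} (hE : E.card = 3) (hA : A ⊆ E) :
    A = ∅ ∨ (∃ p ∈ E, A = {p}) ∨ (∃ r ∈ E, A = E.erase r) ∨ A = E := by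
  have hle := Finset.card_le_card hA
  have hsd := Finset.card_sdiff_of_subset hA
  rw [hE] at hle hsd
  interval_cases h : A.card
  · exact Or.inl (Finset.card_eq_zero.1 h)
  · obtain ⟨p, rfl⟩ := Finset.card_eq_one.1 h
    exact Or.inr (Or.inl ⟨p, by simpa using hA, rfl⟩)
  · obtain ⟨r, hr⟩ := Finset.card_eq_one.1 hsd
    have hrE : r ∈ E \ A := by simp [hr]
    refine Or.inr (Or.inr (Or.inl ⟨r, (Finset.mem_sdiff.1 hrE).1, ?_⟩))
    rw [← Finset.sdiff_singleton_eq_erase, ← hr, Finset.sdiff_sdiff_eq_self hA]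
  · exact Or.inr (Or.inr (Or.inr (Finset.eq_of_subset_of_card_le hA (by omega))))

/-- For a three-element set `E`, the function on the subsets of `E` that is `m` on `E`,
`m - e r` on the complement of `r`, `m - v p` on the singleton of `p`, and `z₀` on the empty set. -/
def levelValues (E : Finset α) (m z₀ : ℝ) (e v : α → ℝ) (A : Finset α) : ℝ :=
  if A = ∅ then z₀ else if A.card = 1 then m - ∑ p ∈ A, v p else m - ∑ r ∈ E \ A, e r

/-- A submodular function `z` with prescribed value `m` at `E`, upper bounds `U` for its values and
upper bounds `s` for its increments exists if `key` holds. The remaining hypotheses say that `s` and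
`U` already satisfy the obvious consequences of these bounds. -/
theorem exists_submodular_of_step_bounds {E : Finset α} (hE : E.card = 3) {U : Finset α → ℝ}
    {s : Finset α → α → ℝ} {m : ℝ}
    (hs_nonneg : ∀ p ∈ E, 0 ≤ s (E.erase p) p)
    (hs_anti : ∀ A ⊆ E, ∀ p ∈ E, ∀ q ∈ E, p ∉ A → q ∉ A → p ≠ q → s (insert q A) p ≤ s A p)
    (hU : ∀ A ⊆ E, ∀ p ∈ E, p ∉ A → U (insert p A) ≤ U A + s A p)
    (hm : m ≤ U E)
    (key : ∀ p ∈ E, ∀ q ∈ E, ∀ r ∈ E, p ≠ q → p ≠ r → q ≠ r →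
      2 * m ≤ U {p} + U {q} + s (E.erase q) q + s (E.erase r) r + s ∅ r + s {r} p) :
    ∃ z : Finset α → ℝ, z E = m ∧ (∀ A ⊆ E, z A ≤ U A) ∧
      (∀ A ⊆ E, ∀ p ∈ E, p ∉ A → z (insert p A) ≤ z A + s A p) ∧
      (∀ A ⊆ E, ∀ p ∈ E, ∀ q ∈ E, p ∉ A → q ∉ A → p ≠ q →
        z (insert p (insert q A)) + z A ≤ z (insert p A) + z (insert q A)) ∧
      ∀ p ∈ E, z (E.erase p) ≤ z E := by
  -- `e r` is the largest possible value of `m - z (E.erase r)`, and this is the value chosen.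
  set e : α → ℝ := fun p => s (E.erase p) p with he
  -- `e q ≤ s {p} q ≤ s ∅ q`
  have he1 : ∀ p ∈ E, ∀ q ∈ E, p ≠ q → e q ≤ s {p} q := by
    intro p hp q hq hpq
    obtain ⟨r, hr, hpr, hqr⟩ := exists_third hE p q
    have := hs_anti {p} (by simpa using hp) q hq r hr (by simpa using hpq.symm)
      (by simpa using hpr.symm) hqr
    rwa [← erase_eq_pair hE hr hp hq hpr.symm hqr.symm hpq] at this
  have hs0 : ∀ p ∈ E, ∀ q ∈ E, p ≠ q → s {p} q ≤ s ∅ q := by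
    intro p hp q hq hpq
    simpa using hs_anti ∅ (by simp) q hq p hp (by simp) (by simp) hpq.symm
  have hU1 : ∀ p ∈ E, U {p} ≤ U ∅ + s ∅ p := by
    intro p hp
    simpa using hU ∅ (by simp) p hp (by simp)
  have hU2 : ∀ p ∈ E, ∀ q ∈ E, p ≠ q → U {p, q} ≤ U {p} + s {p} q := by
    intro p hp q hq hpq
    simpa [Finset.pair_comm] using hU {p} (by simpa using hp) q hq (by simpa using hpq.symm)
  have hU3 : ∀ r ∈ E, m ≤ U (E.erase r) + e r := by
    intro r hr
    have := hU (E.erase r) (Finset.erase_subset _ _) r hr (by simp)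
    rw [Finset.insert_erase hr] at this
    exact hm.trans this
  have hm1 : ∀ p ∈ E, ∀ q ∈ E, ∀ r ∈ E, p ≠ q → p ≠ r → q ≠ r →
      m ≤ U {p} + s {p} q + e r := by
    intro p hp q hq r hr hpq hpr hqr
    have h1 := hU3 r hr
    rw [erase_eq_pair hE hp hq hr hpq hpr hqr] at h1
    linarith [hU2 p hp q hq hpq]
  -- `v p` stands for `m - z {p}`; `lo p` is its lower bound from `z {p} ≤ U {p}` and submodularity
  -- over `{p}`. The constraints `v p + v q ≤ v r + (e r + s ∅ r)` hold for `v = lo` except possibly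
  -- for one `r`, since the sum of two of them is `two_lo` below; raising `lo r` just enough for the
  -- constraint to hold does not affect the others.
  set lo : α → ℝ := fun p => max (∑ i ∈ E.erase p, e i) (m - U {p}) with hlo
  set v : α → ℝ := fun p => max (lo p) (∑ i ∈ E.erase p, lo i - (e p + s ∅ p)) with hv
  have sum_erase : ∀ (w : α → ℝ), ∀ p ∈ E, ∀ q ∈ E, ∀ r ∈ E, p ≠ q → p ≠ r → q ≠ r →
      ∑ i ∈ E.erase r, w i = w p + w q := by
    intro w p hp q hq r hr hpq hpr hqr
    rw [erase_eq_pair hE hp hq hr hpq hpr hqr, Finset.sum_pair hpq]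
  have lo_cases : ∀ p ∈ E, ∀ q ∈ E, ∀ r ∈ E, p ≠ q → p ≠ r → q ≠ r →
      e p + e q ≤ lo r ∧ m - U {r} ≤ lo r ∧ (lo r = e p + e q ∨ lo r = m - U {r}) := by
    intro p hp q hq r hr hpq hpr hqr
    simp only [hlo]
    rw [sum_erase e p hp q hq r hr hpq hpr hqr]
    exact ⟨le_max_left _ _, le_max_right _ _, max_choice _ _⟩
  have v_cases : ∀ p ∈ E, ∀ q ∈ E, ∀ r ∈ E, p ≠ q → p ≠ r → q ≠ r →
      lo r ≤ v r ∧ lo p + lo q - (e r + s ∅ r) ≤ v r ∧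
        (v r = lo r ∨ v r = lo p + lo q - (e r + s ∅ r)) := by
    intro p hp q hq r hr hpq hpr hqr
    simp only [hv]
    rw [sum_erase lo p hp q hq r hr hpq hpr hqr]
    exact ⟨le_max_left _ _, le_max_right _ _, max_choice _ _⟩
  have two_lo : ∀ p ∈ E, ∀ q ∈ E, ∀ r ∈ E, p ≠ q → p ≠ r → q ≠ r →
      2 * lo r ≤ e p + s ∅ p + (e q + s ∅ q) := by
    intro p hp q hq r hr hpq hpr hqr
    have := he1 r hr p hp hpr.symm
    have := he1 r hr q hq hqr.symm
    have := hs0 r hr p hp hpr.symm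
    have := hs0 r hr q hq hqr.symm
    have := hm1 r hr p hp q hq hpr.symm hqr.symm hpq
    have := hm1 r hr q hq p hp hqr.symm hpr.symm hpq.symm
    obtain ⟨-, -, h | h⟩ := lo_cases p hp q hq r hr hpq hpr hqr <;> linarith
  -- `z {p, q} ≤ z {p} + s {p} q`
  have v_le : ∀ p ∈ E, ∀ q ∈ E, ∀ r ∈ E, p ≠ q → p ≠ r → q ≠ r → v p ≤ e r + s {p} q := by
    intro p hp q hq r hr hpq hpr hqr
    have := he1 p hp q hq hpq
    have := hs0 q hq p hp hpq.symm
    have := hs0 r hr p hp hpr.symm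
    have := he1 r hr p hp hpr.symm
    have := hm1 p hp q hq r hr hpq hpr hqr
    have := hm1 q hq p hp r hr hpq.symm hqr hpr
    have := hm1 r hr p hp q hq hpr.symm hqr.symm hpq
    have := key q hq r hr p hp hqr hpq.symm hpr.symm
    have hp' := lo_cases q hq r hr p hp hqr hpq.symm hpr.symm
    have hq' := lo_cases p hp r hr q hq hpr hpq hqr.symm
    have hr' := lo_cases p hp q hq r hr hpq hpr hqr
    obtain ⟨-, -, hv' | hv'⟩ := v_cases q hq r hr p hp hqr hpq.symm hpr.symm
    · obtain ⟨-, -, h | h⟩ := hp' <;> linarith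
    · obtain ⟨-, -, h | h⟩ := hq' <;> obtain ⟨-, -, h' | h'⟩ := hr' <;> linarith
  -- `z {p, q} + z ∅ ≤ z {p} + z {q}`, where `z ∅ = z {r} - s ∅ r`
  have v_add_le : ∀ p ∈ E, ∀ q ∈ E, ∀ r ∈ E, p ≠ q → p ≠ r → q ≠ r →
      v p + v q ≤ v r + e r + s ∅ r := by
    intro p hp q hq r hr hpq hpr hqr
    have hp' := v_cases q hq r hr p hp hqr hpq.symm hpr.symm
    have hq' := v_cases p hp r hr q hq hpr hpq hqr.symm
    have hr' := v_cases p hp q hq r hr hpq hpr hqr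
    have := two_lo q hq r hr p hp hqr hpq.symm hpr.symm
    have := two_lo p hp r hr q hq hpr hpq hqr.symm
    have := two_lo p hp q hq r hr hpq hpr hqr
    obtain ⟨-, -, h | h⟩ := hp' <;> obtain ⟨-, -, h' | h'⟩ := hq' <;> linarith
  -- The least `z ∅` allowed by the bounds for the increments from `∅`; `t` is where it is attained.
  have hne : E.Nonempty := Finset.card_pos.1 (by omega)
  obtain ⟨t, ht, ht_max⟩ := Finset.exists_max_image E (fun p => m - v p - s ∅ p) hne
  set z₀ : ℝ := m - v t - s ∅ t with hz₀
  have lo_le_v : ∀ p ∈ E, m - U {p} ≤ v p := fun p _ =>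
    (le_max_right _ _).trans (le_max_left _ _)
  have z₀_le_U : z₀ ≤ U ∅ := by linarith [lo_le_v t ht, hU1 t ht]
  have z₀_le : ∀ p ∈ E, ∀ q ∈ E, ∀ r ∈ E, p ≠ q → p ≠ r → q ≠ r →
      m - e r + z₀ ≤ m - v p + (m - v q) := by
    intro p hp q hq r hr hpq hpr hqr
    have ht' := ht
    rw [eq_triple hE hp hq hr hpq hpr hqr] at ht'
    simp only [Finset.mem_insert, Finset.mem_singleton] at ht'
    rcases ht' with rfl | rfl | rfl
    · linarith [v_le q hq t hp r hr hpq.symm hqr hpr, hs0 q hq t hp hpq.symm]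
    · linarith [v_le p hp t hq r hr hpq hpr hqr, hs0 p hp t hq hpq]
    · linarith [v_add_le p hp q hq t hr hpq hpr hqr]
  have z_empty : levelValues E m z₀ e v ∅ = z₀ := if_pos rfl
  have z_one : ∀ p, levelValues E m z₀ e v {p} = m - v p := fun p => by simp [levelValues]
  have z_two : ∀ p ∈ E, ∀ q ∈ E, ∀ r ∈ E, p ≠ q → p ≠ r → q ≠ r →
      levelValues E m z₀ e v {p, q} = m - e r := by
    intro p hp q hq r hr hpq hpr hqr
    rw [← erase_eq_pair hE hp hq hr hpq hpr hqr, levelValues, if_neg, if_neg,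
      Finset.sdiff_erase_self hr, Finset.sum_singleton]
    · rw [Finset.card_erase_of_mem hr]; omega
    · rw [← Finset.card_eq_zero, Finset.card_erase_of_mem hr]; omega
  have z_three : levelValues E m z₀ e v E = m := by
    simp [levelValues, hE, hne.ne_empty]
  have z_erase : ∀ r ∈ E, levelValues E m z₀ e v (E.erase r) = m - e r := by
    intro r hr
    obtain ⟨p, hp, hrp, -⟩ := exists_third hE r r
    obtain ⟨q, hq, hrq, hpq⟩ := exists_third hE r p
    rw [erase_eq_pair hE hp hq hr hpq hrp.symm hrq.symm]
    exact z_two p hp q hq r hr hpq hrp.symm hrq.symm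
  refine ⟨levelValues E m z₀ e v, z_three, fun A hA => ?_, fun A hA p hp hpA => ?_,
    fun A hA p hp q hq hpA hqA hpq => ?_, fun p hp => ?_⟩
  · obtain rfl | ⟨p, hp, rfl⟩ | ⟨r, hr, rfl⟩ | rfl := subset_cases hE hA
    · rwa [z_empty]
    · rw [z_one]
      linarith [lo_le_v p hp]
    · rw [z_erase r hr]
      linarith [hU3 r hr]
    · rwa [z_three]
  · obtain rfl | ⟨q, hq, rfl⟩ | ⟨r, hr, rfl⟩ | rfl := subset_cases hE hA
    · rw [z_empty, Finset.insert_empty, z_one]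
      linarith [ht_max p hp]
    · rw [Finset.mem_singleton] at hpA
      obtain ⟨r, hr, hpr, hqr⟩ := exists_third hE p q
      rw [z_one, z_two p hp q hq r hr hpA hpr hqr]
      linarith [v_le q hq p hp r hr (Ne.symm hpA) hqr hpr]
    · obtain rfl : p = r := by simpa [hp] using hpA
      rw [Finset.insert_erase hp, z_three, z_erase p hp, he]
      linarith
    · exact absurd hp hpA
  · obtain ⟨r, hr, hpr, hqr⟩ := exists_third hE p q
    have hA' : A ⊆ {r} := by
      intro i hi
      have := hA hi
      rw [eq_triple hE hp hq hr hpq hpr hqr] at this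
      simp only [Finset.mem_insert, Finset.mem_singleton] at this ⊢
      rcases this with rfl | rfl | rfl
      · exact absurd hi hpA
      · exact absurd hi hqA
      · rfl
    obtain rfl | rfl := Finset.subset_singleton_iff.1 hA'
    · rw [z_empty, Finset.insert_empty, Finset.insert_empty, z_one, z_one,
        z_two p hp q hq r hr hpq hpr hqr]
      linarith [z₀_le p hp q hq r hr hpq hpr hqr]
    · rw [← eq_triple hE hp hq hr hpq hpr hqr, z_three, z_one,
        z_two p hp r hr q hq hpr hpq hqr.symm, z_two q hq r hr p hp hqr hpq.symm hpr.symm]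
      linarith [(lo_cases p hp q hq r hr hpq hpr hqr).1,
        (v_cases p hp q hq r hr hpq hpr hqr).1]
  · rw [z_erase p hp, z_three]
    linarith [hs_nonneg p hp]

/-! ### Bounds on the values of an amalgam -/

section Bounds

variable (f g : Finset α → ℝ) (x y : α)

/-- The upper bound for the value of an amalgam of `f` and `g` on `A ∪ {x, y}` that follows from
submodularity for `x` and `y` over `A`. -/
def upper (A : Finset α) : ℝ := f (insert x A) + g (insert y A) - f A

/-- The upper bound for the increment of an amalgam of `f` and `g` from `A ∪ {x, y}` to
`A ∪ {x, y, p}`: the smaller one of the increments of `f` over `A ∪ {x}` and of `g` over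
`A ∪ {y}`. -/
def step (A : Finset α) (p : α) : ℝ :=
  min (f (insert x (insert p A)) - f (insert x A)) (g (insert y (insert p A)) - g (insert y A))

/-- The lower bound for the rank of an amalgam of `f` and `g` that follows from monotonicity. -/
def top (E : Finset α) : ℝ := max (f (insert x E)) (g (insert y E))

variable {f g x y} {E A : Finset α}

lemma step_erase_nonneg (hf : IsPolymatroid (insert x E) f) (hg : IsPolymatroid (insert y E) g)
    {p : α} (hp : p ∈ E) : 0 ≤ step f g x y (E.erase p) p := by
  rw [step, Finset.insert_erase hp, le_min_iff, sub_nonneg, sub_nonneg]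
  exact ⟨hf.mono _ _ (Finset.insert_subset_insert _ (Finset.erase_subset _ _)) subset_rfl,
    hg.mono _ _ (Finset.insert_subset_insert _ (Finset.erase_subset _ _)) subset_rfl⟩

lemma IsPolymatroid.increment_anti (hf : IsPolymatroid (insert x E) f) (hx : x ∉ E) (hA : A ⊆ E)
    {p q : α} (hp : p ∈ E) (hq : q ∈ E) (hpA : p ∉ A) (hpq : p ≠ q) :
    f (insert x (insert p (insert q A))) - f (insert x (insert q A)) ≤
      f (insert x (insert p A)) - f (insert x A) := by
  have h := hf.insert_insert_le (K := insert x A) (i := p) (j := q) (by grind) (by grind) (by grind)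
    (by grind) hpq
  rw [Finset.insert_comm q x, Finset.insert_comm p x, Finset.insert_comm p x] at h
  linarith

lemma step_insert_le (hf : IsPolymatroid (insert x E) f) (hg : IsPolymatroid (insert y E) g)
    (hx : x ∉ E) (hy : y ∉ E) (hA : A ⊆ E) {p q : α} (hp : p ∈ E) (hq : q ∈ E) (hpA : p ∉ A)
    (hpq : p ≠ q) : step f g x y (insert q A) p ≤ step f g x y A p :=
  min_le_min (hf.increment_anti hx hA hp hq hpA hpq) (hg.increment_anti hy hA hp hq hpA hpq)

lemma IsPolymatroid.insert_add_le (hf : IsPolymatroid (insert x E) f) (hx : x ∉ E) (hA : A ⊆ E)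
    {p : α} (hp : p ∈ E) :
    f (insert x (insert p A)) + f A ≤ f (insert x A) + f (insert p A) :=
  hf.insert_insert_le (hA.trans (Finset.subset_insert _ _)) (by simp) (by simp [hp])
    (fun h => hx (hA h)) (fun h => hx (h ▸ hp))

lemma upper_insert_le (hf : IsPolymatroid (insert x E) f) (hg : IsPolymatroid (insert y E) g)
    (hfg : AgreeOn E f g) (hx : x ∉ E) (hy : y ∉ E) (hA : A ⊆ E) {p : α} (hp : p ∈ E) :
    upper f g x y (insert p A) ≤ upper f g x y A + step f g x y A p := by
  have h1 := hf.insert_add_le hx hA hp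
  have h2 := hg.insert_add_le hy hA hp
  have h3 := hfg A hA
  have h4 := hfg (insert p A) (Finset.insert_subset hp hA)
  simp only [upper, step]
  rcases min_choice (f (insert x (insert p A)) - f (insert x A))
    (g (insert y (insert p A)) - g (insert y A)) with h | h <;> rw [h] <;> linarith

lemma upper_swap (hfg : AgreeOn E f g) (hA : A ⊆ E) : upper g f y x A = upper f g x y A := by
  rw [upper, upper, hfg A hA, add_comm]

lemma step_swap (p : α) : step g f y x A p = step f g x y A p := min_comm _ _

lemma top_swap : top g f y x E = top f g x y E := max_comm _ _

lemma step_le_left (p : α) :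
    step f g x y A p ≤ f (insert x (insert p A)) - f (insert x A) := min_le_left _ _

lemma step_le_right (p : α) :
    step f g x y A p ≤ g (insert y (insert p A)) - g (insert y A) := min_le_right _ _

lemma top_le_upper (hf : IsPolymatroid (insert x E) f) (hg : IsPolymatroid (insert y E) g)
    (hfg : AgreeOn E f g) : top f g x y E ≤ upper f g x y E := by
  have h1 := hf.mono E _ (Finset.subset_insert x E) subset_rfl
  have h2 := hg.mono E _ (Finset.subset_insert y E) subset_rfl
  have h3 := hfg E subset_rfl
  refine max_le ?_ ?_ <;> rw [upper] <;> linarith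

end Bounds

/-! ### The amalgam inequalities as bounds -/

section Inequality

variable {f g : Finset α → ℝ} {x y : α} {E : Finset α}

/-- The eight amalgam inequalities for the points `p`, `q`, `r` of `E` bound twice the rank of an
amalgam: the choices of the terms `t₁`, `t₂`, `t₃` correspond to those of the extrema in
`step (E.erase q) q`, `step (E.erase r) r` and `top E`. -/
lemma amalgamInequality_iff (hfg : AgreeOn E f g) (h0 : f ∅ = 0) {p q r : α} (hpq : p ≠ q)
    (hpr : p ≠ r) (hqr : q ≠ r) (hE : E = {p, q, r}) :
    AmalgamInequality f g p q r x y ↔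
      2 * top f g x y E ≤ upper f g x y {p} + upper f g x y {q} + step f g x y (E.erase q) q
        + step f g x y (E.erase r) r + (f {x, r} - f {x}) + (g {y, p, r} - g {y, r}) := by
  have hq : E.erase q = {p, r} := by rw [hE]; grind
  have hr : E.erase r = {p, q} := by rw [hE]; grind
  have hqE : insert q (E.erase q) = E := Finset.insert_erase (by simp [hE])
  have hrE : insert r (E.erase r) = E := Finset.insert_erase (by simp [hE])
  have sub : ∀ A ⊆ ({p, q, r} : Finset α), g A = f A := fun A hA => (hfg A (hE ▸ hA)).symm
  have g0 : g ∅ = 0 := by rw [sub _ (by simp), h0]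
  have gp : g {p} = f {p} := sub _ (by simp)
  have gq : g {q} = f {q} := sub _ (by simp)
  have gr : g {r} = f {r} := sub _ (by simp)
  have gpq : g {p, q} = f {p, q} := sub _ (by grind)
  have gpr : g {p, r} = f {p, r} := sub _ (by grind)
  have gE : g E = f E := (hfg E subset_rfl).symm
  have i1 : info f {p} {q} = f {p} + f {q} - f {p, q} := by
    simp only [info, condInfo, Finset.union_empty, h0]
    rw [show ({p} ∪ {q} : Finset α) = {p, q} by grind]; ring
  have i2 : condInfo f {p} {x} {r} = f {p, r} + f {x, r} - f {x, p, r} - f {r} := by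
    rw [condInfo, show ({p} ∪ {r} : Finset α) = {p, r} by grind,
      show ({x} ∪ {r} : Finset α) = {x, r} by grind,
      show ({p} ∪ {x} ∪ {r} : Finset α) = {x, p, r} by grind]
  have i3 : ∀ (h : Finset α → ℝ) (z : α),
      condInfo h {p} {q} {z} = h {z, p} + h {z, q} - h {z, p, q} - h {z} := by
    intro h z
    rw [condInfo, show ({p} ∪ {z} : Finset α) = {z, p} by grind,
      show ({q} ∪ {z} : Finset α) = {z, q} by grind,
      show ({p} ∪ {q} ∪ {z} : Finset α) = {z, p, q} by grind]
  have i4 : info g {r} {y} = f {r} + g {y} - g {y, r} := by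
    simp only [info, condInfo, Finset.union_empty, g0, gr]
    rw [show ({r} ∪ {y} : Finset α) = {y, r} by grind]; ring
  have i5 : ∀ (h : Finset α → ℝ) (z : α),
      condInfo h {q} {z} {p, r} = h E + h {z, p, r} - h (insert z E) - h {p, r} := by
    intro h z
    rw [condInfo, show ({q} ∪ {p, r} : Finset α) = E by grind,
      show ({z} ∪ {p, r} : Finset α) = {z, p, r} by grind,
      show ({q} ∪ {z} ∪ {p, r} : Finset α) = insert z E by grind]
  have i6 : ∀ (h : Finset α → ℝ) (z : α),
      condInfo h {r} {z} {p, q} = h E + h {z, p, q} - h (insert z E) - h {p, q} := by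
    intro h z
    rw [condInfo, show ({r} ∪ {p, q} : Finset α) = E by grind,
      show ({z} ∪ {p, q} : Finset α) = {z, p, q} by grind,
      show ({r} ∪ {z} ∪ {p, q} : Finset α) = insert z E by grind]
  have i7 : ∀ (h : Finset α → ℝ) (z : α), condRank h {z} {p, q, r} = h (insert z E) - h E := by
    intro h z
    rw [condRank, ← hE, show ({z} ∪ E : Finset α) = insert z E by grind]
  simp only [AmalgamInequality, Set.mem_insert_iff, Set.mem_singleton_iff, forall_eq_or_imp,
    forall_eq, i1, i2, i3, i4, i5, i6, i7, step, top, upper, hqE, hrE, gE, gpq, gpr]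
  rw [hq, hr]
  set F := f (insert x E)
  set G := g (insert y E)
  constructor
  · rintro ⟨⟨⟨h1, h2⟩, h3, h4⟩, ⟨h5, h6⟩, h7, h8⟩
    rcases max_choice F G with h | h <;> rw [h] <;>
    rcases min_choice (F - f {x, p, r}) (G - g {y, p, r}) with h' | h' <;> rw [h'] <;>
    rcases min_choice (F - f {x, p, q}) (G - g {y, p, q}) with h'' | h'' <;> rw [h''] <;>
    linarith
  · intro h
    have := le_max_left F G
    have := le_max_right F G
    have := min_le_left (F - f {x, p, r}) (G - g {y, p, r})
    have := min_le_right (F - f {x, p, r}) (G - g {y, p, r})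
    have := min_le_left (F - f {x, p, q}) (G - g {y, p, q})
    have := min_le_right (F - f {x, p, q}) (G - g {y, p, q})
    refine ⟨⟨⟨?_, ?_⟩, ?_, ?_⟩, ⟨?_, ?_⟩, ?_, ?_⟩ <;> linarith

end Inequality

/-! ### Necessity and sufficiency -/

section Main

variable {f g h : Finset α → ℝ} {x y : α} {E : Finset α}

omit [DecidableEq α] in
lemma AgreeOn.symm {M : Finset α} (hfg : AgreeOn M f g) : AgreeOn M g f :=
  fun A hA => (hfg A hA).symm

/-- A polymatroid extending `f` and `g` satisfies the bounds that encode the amalgam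
inequalities. -/
lemma two_top_le_of_extension (hxy : x ≠ y) (hx : x ∉ E) (hy : y ∉ E)
    (hh : IsPolymatroid (insert x (insert y E)) h) (hhf : AgreeOn (insert x E) h f)
    (hhg : AgreeOn (insert y E) h g) {p q r : α} (hp : p ∈ E) (hq : q ∈ E) (hr : r ∈ E)
    (hpq : p ≠ q) (hpr : p ≠ r) (hqr : q ≠ r) (hE : E.card = 3) :
    2 * top f g x y E ≤ upper f g x y {p} + upper f g x y {q} + step f g x y (E.erase q) q
      + step f g x y (E.erase r) r + (f {x, r} - f {x}) + (g {y, p, r} - g {y, r}) := by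
  have le_upper : ∀ A ⊆ E, h (insert x (insert y A)) ≤ upper f g x y A := by
    intro A hA
    have h1 := hh.insert_insert_le (K := A) (i := x) (j := y)
      (hA.trans ((Finset.subset_insert _ _).trans (Finset.subset_insert _ _))) (by simp) (by simp)
      (fun h => hx (hA h)) hxy
    rw [hhf A (hA.trans (Finset.subset_insert _ _)), hhf _ (Finset.insert_subset_insert _ hA),
      hhg _ (Finset.insert_subset_insert _ hA)] at h1
    rw [upper]
    linarith
  have incf : ∀ A ⊆ E, ∀ p ∈ E, h (insert x (insert y (insert p A))) - h (insert x (insert y A)) ≤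
      f (insert x (insert p A)) - f (insert x A) := by
    intro A hA p hp
    have h1 := hh.insert_insert_le (K := insert x A) (i := y) (j := p)
      (Finset.insert_subset_insert _ (hA.trans (Finset.subset_insert _ _))) (by simp)
      (by simp [hp]) (by simpa [hxy.symm] using fun h => hy (hA h)) (fun h => hy (h ▸ hp))
    rw [Finset.insert_comm p x, Finset.insert_comm y x, Finset.insert_comm y x,
      hhf _ (Finset.insert_subset_insert _ hA),
      hhf _ (Finset.insert_subset_insert _ (Finset.insert_subset hp hA))] at h1
    linarith
  have incg : ∀ A ⊆ E, ∀ p ∈ E, h (insert x (insert y (insert p A))) - h (insert x (insert y A)) ≤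
      g (insert y (insert p A)) - g (insert y A) := by
    intro A hA p hp
    have h1 := hh.insert_insert_le (K := insert y A) (i := x) (j := p)
      ((Finset.insert_subset_insert _ hA).trans (Finset.subset_insert _ _)) (by simp)
      (by simp [hp]) (by simpa [hxy] using fun h => hx (hA h)) (fun h => hx (h ▸ hp))
    rw [Finset.insert_comm p y, hhg _ (Finset.insert_subset_insert _ hA),
      hhg _ (Finset.insert_subset_insert _ (Finset.insert_subset hp hA))] at h1
    linarith
  have inc : ∀ p ∈ E, h (insert x (insert y E)) - h (insert x (insert y (E.erase p))) ≤
      step f g x y (E.erase p) p := by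
    intro p hp
    have h1 := incf (E.erase p) (Finset.erase_subset _ _) p hp
    have h2 := incg (E.erase p) (Finset.erase_subset _ _) p hp
    rw [Finset.insert_erase hp] at h1 h2
    rw [step, Finset.insert_erase hp]
    exact le_min h1 h2
  have top_le : top f g x y E ≤ h (insert x (insert y E)) := by
    refine max_le ?_ ?_
    · rw [← hhf _ subset_rfl]
      exact hh.mono _ _ (Finset.insert_subset_insert _ (Finset.subset_insert _ _)) subset_rfl
    · rw [← hhg _ subset_rfl]
      exact hh.mono _ _ (Finset.subset_insert _ _) subset_rfl
  have hq' : E.erase q = {p, r} := erase_eq_pair hE hp hr hq hpr hpq hqr.symm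
  have hr' : E.erase r = {p, q} := erase_eq_pair hE hp hq hr hpq hpr hqr
  have h1 := le_upper {p} (by simpa using hp)
  have h2 := le_upper {q} (by simpa using hq)
  have h3 := inc q hq
  have h4 := inc r hr
  rw [hq'] at h3
  rw [hr'] at h4
  have h5 := incf ∅ (by simp) r hr
  have h6 := incg {r} (by simpa using hr) p hp
  have h7 := hh.insert_insert_le (K := {x, y}) (i := p) (j := q)
    (by simp [Finset.insert_subset_iff])
    (by simp [hp]) (by simp [hq])
    (by simpa using ⟨fun e => hx (e ▸ hp), fun e => hy (e ▸ hp)⟩) hpq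
  rw [Finset.insert_comm q, Finset.pair_comm q y, Finset.insert_comm p x, Finset.insert_comm p y,
    Finset.insert_comm p x, Finset.pair_comm p y] at h7
  rw [hq', hr']
  simp only [Finset.insert_empty] at h5
  linarith

/-- If both increments in the last two terms come from the same polymatroid, the bound holds
for any two polymatroids. -/
lemma two_top_le_of_same (hf : IsPolymatroid (insert x E) f) (hg : IsPolymatroid (insert y E) g)
    (hfg : AgreeOn E f g) (hx : x ∉ E) (hy : y ∉ E) {p q r : α} (hp : p ∈ E) (hq : q ∈ E)
    (hr : r ∈ E) (hpq : p ≠ q) (hpr : p ≠ r) (hqr : q ≠ r) (hE : E.card = 3) :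
    2 * top f g x y E ≤ upper f g x y {p} + upper f g x y {q} + step f g x y (E.erase q) q
      + step f g x y (E.erase r) r + (f {x, r} - f {x}) + (f {x, p, r} - f {x, r}) := by
  have hm := top_le_upper hf hg hfg
  have sub1 : ∀ i ∈ E, ({i} : Finset α) ⊆ E := fun i hi => by simpa using hi
  have hUE : ∀ i ∈ E, upper f g x y E ≤ upper f g x y (E.erase i) + step f g x y (E.erase i) i := by
    intro i hi
    have h1 := upper_insert_le hf hg hfg hx hy (Finset.erase_subset i E) hi
    rwa [Finset.insert_erase hi] at h1
  have h1 := hUE q hq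
  have h2 := hUE r hr
  -- `upper {p, r} ≤ upper {p} + (f {x, p, r} - f {x, p})`
  have h3 := upper_insert_le hf hg hfg hx hy (sub1 p hp) hr
  have h4 := step_le_left (f := f) (g := g) (x := x) (y := y) (A := {p}) r
  -- `upper {p, q} ≤ upper {q} + (f {x, p} - f {x})`
  have h5 := upper_insert_le hf hg hfg hx hy (sub1 q hq) hp
  have h6 := step_le_left (f := f) (g := g) (x := x) (y := y) (A := {q}) p
  have h7 := hf.increment_anti hx (A := ∅) (by simp) hp hq (by simp) hpq
  rw [erase_eq_pair hE hr hp hq hpr.symm hqr.symm hpq] at h1 ⊢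
  rw [erase_eq_pair hE hp hq hr hpq hpr hqr] at h2 ⊢
  rw [Finset.pair_comm p r]
  simp only [Finset.insert_empty] at h7
  linarith

/-- The criterion for an arbitrary three-element set `E` in place of `{a, b, c}`. -/
theorem hasAmalgam_iff (hxy : x ≠ y) (hx : x ∉ E) (hy : y ∉ E) (hE : E.card = 3)
    (hf : IsPolymatroid (insert x E) f) (hg : IsPolymatroid (insert y E) g)
    (hfg : AgreeOn E f g) :
    HasAmalgam (insert x E) (insert y E) f g ↔
      ∀ p ∈ E, ∀ q ∈ E, ∀ r ∈ E, p ≠ q → p ≠ r → q ≠ r →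
        AmalgamInequality f g p q r x y ∧ AmalgamInequality g f p q r y x := by
  have hN : insert x E ∪ insert y E = insert x (insert y E) := by
    rw [Finset.insert_union, Finset.union_insert, Finset.union_self]
  constructor
  · rintro ⟨h, hh, hhf, hhg⟩ p hp q hq r hr hpq hpr hqr
    rw [hN] at hh
    have hE' := eq_triple hE hp hq hr hpq hpr hqr
    rw [amalgamInequality_iff hfg hf.empty hpq hpr hqr hE',
      amalgamInequality_iff hfg.symm hg.empty hpq hpr hqr hE']
    refine ⟨two_top_le_of_extension hxy hx hy hh hhf hhg hp hq hr hpq hpr hqr hE, ?_⟩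
    rw [Finset.insert_comm] at hh
    exact two_top_le_of_extension hxy.symm hy hx hh hhg hhf hp hq hr hpq hpr hqr hE
  · intro H
    obtain ⟨z, hzE, hzU, hzs, hzsub, hzmono⟩ := exists_submodular_of_step_bounds hE
      (U := upper f g x y) (s := step f g x y) (m := top f g x y E)
      (fun p hp => step_erase_nonneg hf hg hp)
      (fun A hA p hp q hq hpA _ hpq => step_insert_le hf hg hx hy hA hp hq hpA hpq)
      (fun A hA p hp _ => upper_insert_le hf hg hfg hx hy hA hp) (top_le_upper hf hg hfg) (by
        intro p hp q hq r hr hpq hpr hqr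
        have hE' := eq_triple hE hp hq hr hpq hpr hqr
        have hp1 : ({p} : Finset α) ⊆ E := by simpa using hp
        have hq1 : ({q} : Finset α) ⊆ E := by simpa using hq
        obtain ⟨h1, h2⟩ := H p hp q hq r hr hpq hpr hqr
        rw [amalgamInequality_iff hfg hf.empty hpq hpr hqr hE'] at h1
        rw [amalgamInequality_iff hfg.symm hg.empty hpq hpr hqr hE', upper_swap hfg hp1,
          upper_swap hfg hq1, step_swap q, step_swap r, top_swap] at h2
        have h3 := two_top_le_of_same hf hg hfg hx hy hp hq hr hpq hpr hqr hE
        have h4 := two_top_le_of_same hg hf hfg.symm hy hx hp hq hr hpq hpr hqr hE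
        rw [upper_swap hfg hp1, upper_swap hfg hq1, step_swap q, step_swap r, top_swap] at h4
        have h5 : step f g x y ∅ r = min (f {x, r} - f {x}) (g {y, r} - g {y}) := rfl
        have h6 : step f g x y {r} p =
          min (f {x, p, r} - f {x, r}) (g {y, p, r} - g {y, r}) := rfl
        rcases min_choice (f {x, r} - f {x}) (g {y, r} - g {y}) with h | h <;>
        rcases min_choice (f {x, p, r} - f {x, r}) (g {y, p, r} - g {y, r}) with h' | h' <;>
        rw [h] at h5 <;> rw [h'] at h6 <;> rw [h5, h6] <;> assumption)
    have hglue : Elemental (insert x (insert y E)) (glue f g z x y) := by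
      refine elemental_glue hxy hx hy hf hg hfg (fun A hA => ?_) (fun A hA p hp hpA => ?_)
        (fun A hA p hp hpA => ?_) hzsub (hzE ▸ le_max_left _ _) (hzE ▸ le_max_right _ _) hzmono
      · have := hzU A hA
        rw [upper] at this
        linarith
      · linarith [hzs A hA p hp hpA, step_le_left (f := f) (g := g) (x := x) (y := y) (A := A) p]
      · linarith [hzs A hA p hp hpA, step_le_right (f := f) (g := g) (x := x) (y := y) (A := A) p]
    have hgf : AgreeOn (insert x E) (glue f g z x y) f := fun A hA =>
      glue_of_notMem_right fun h => by simpa [hxy.symm, hy] using hA h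
    refine ⟨glue f g z x y, ?_, hgf, fun A hA => ?_⟩
    · rw [hN]
      exact hglue.isPolymatroid ((hgf ∅ (by simp)).trans hf.empty)
    · have hxA : x ∉ A := fun h => by simpa [hxy, hx] using hA h
      by_cases hyA : y ∈ A
      · simp [glue, hxA, hyA]
      · rw [glue_of_notMem_right hyA]
        exact hfg A ((Finset.subset_insert_iff_of_notMem hyA).1 hA)

end Main

end PolymatroidAmalgam

theorem mainTheorem3 {α : Type*} [DecidableEq α] (a b c x y : α)
    (hdistinct : [a, b, c, x, y].Nodup) (fx fy : Finset α → ℝ)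
    (hfx : PolymatroidAmalgam.IsPolymatroid {a, b, c, x} fx)
    (hfy : PolymatroidAmalgam.IsPolymatroid {a, b, c, y} fy)
    (hcommon : PolymatroidAmalgam.AgreeOn {a, b, c} fx fy) :
    PolymatroidAmalgam.HasAmalgam {a, b, c, x} {a, b, c, y} fx fy ↔
      ∀ p q r : α, List.Perm [p, q, r] [a, b, c] →
        PolymatroidAmalgam.AmalgamInequality fx fy p q r x y ∧
        PolymatroidAmalgam.AmalgamInequality fy fx p q r y x := by
  have hset : ∀ z : α, ({a, b, c, z} : Finset α) = insert z {a, b, c} := fun z => by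
    ext; simp; tauto
  rw [hset x] at hfx ⊢
  rw [hset y] at hfy ⊢
  simp only [List.nodup_cons, List.mem_cons, List.not_mem_nil, or_false, not_or] at hdistinct
  obtain ⟨⟨hab, hac, hax, hay⟩, ⟨hbc, hbx, hby⟩, ⟨hcx, hcy⟩, hxy, -⟩ := hdistinct
  rw [PolymatroidAmalgam.hasAmalgam_iff hxy (by simp [Ne.symm hax, Ne.symm hbx, Ne.symm hcx])
    (by simp [Ne.symm hay, Ne.symm hby, Ne.symm hcy])
    (Finset.card_eq_three.2 ⟨a, b, c, hab, hac, hbc, rfl⟩) hfx hfy hcommon]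
  have habc : [a, b, c].Nodup := by simp [hab, hac, hbc]
  constructor
  · intro H p q r hperm
    have hnd := hperm.nodup_iff.2 habc
    simp only [List.nodup_cons, List.mem_cons, List.not_mem_nil, or_false, not_or] at hnd
    have hmem : ∀ i ∈ [p, q, r], i ∈ ({a, b, c} : Finset α) := fun i hi => by
      simpa using hperm.subset hi
    exact H p (hmem p (by simp)) q (hmem q (by simp)) r (hmem r (by simp)) hnd.1.1 hnd.1.2 hnd.2.1
  · intro H p hp q hq r hr hpq hpr hqr
    refine H p q r (List.perm_of_nodup_nodup_toFinset_eq (by simp [hpq, hpr, hqr]) habc ?_)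
    have := PolymatroidAmalgam.eq_triple
      (Finset.card_eq_three.2 ⟨a, b, c, hab, hac, hbc, rfl⟩) hp hq hr hpq hpr hqr
    simpa using this.symm
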